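/- Let $n\ge 2$ and let $\mathcal O_n$ be the Cuntz algebra, the $C^*$-algebra generated by isometries $S_1,\dots,S_n$ with $\sum_{i=1}^n S_iS_i^*=1$. Let $W_n^k$ be the set of words of length $k$ over $\{1,\dots,n\}$ and $W_n=\bigcup_{k\ge0}W_n^k$. For $\mu=\mu_1\cdots\mu_r\in W_n$ put $S_\mu=S_{\mu_1}\cdots S_{\mu_r}$ (with $S_\emptyset=1$) and $P_\mu=S_\mu S_\mu^*$. Let $\mathcal D_n$ be the $C^*$-subalgebra of $\mathcal O_n$ generated by all the $P_\mu$. For a unitary $u\in\mathcal O_n$ let $\lambda_u$ be the unital $*$-endomorphism of $\mathcal O_n$ with $\lambda_u(S_i)=uS_i$ for all $i$. Let $k\ge1$ and let $u=\sum_{\alpha\in W_n^k}S_\alpha S_{\beta(\alpha)}^*$ be a unitary, where $\beta:W_n^k\to W_n$ and $|\alpha|-|\beta(\alpha)|\in\{0,\pm1\}$ for all $\alpha$. (Every unitary that is a finite sum of words $S_\alpha S_\beta^*$ with $|\alpha|-|\beta|\in\{0,\pm1\}$ can be written in this way for some $k$.) Write $\tilde\beta(\alpha)$ for the word $\beta(\alpha)$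 with its first letter removed. Let $\mathcal Z_u$ be the set of all finite products of the elements $S_\alpha S_{\tilde\beta(\alpha)}^*$, $\alpha\in W_n^k$, and their adjoints, and let $\langle\mathcal Z_u\rangle$ be the set of all finite sums of elements of $\mathcal Z_u$. The directed graph $\Delta_u$ has vertex set $W_n^k$, and an edge from $\alpha_1$ to $\alpha_2$ whenever $P_{\alpha_2}\le P_{\tilde\beta(\alpha_1)}$, that is, whenever $\tilde\beta(\alpha_1)$ is an initial subword of $\alpha_2$. The degree of this edge is $d=k-|\tilde\beta(\alpha_1)|\in\{0,1,2\}$, and its label is the terminal subword of length $d$ of $\alpha_2$. The degree $\deg(x)$ of a finite directed path $x$ is the sum of the degrees of its edges, and its label $L(x)$ is the concatenation of the labels of its edges. Let $x=x'e$ and $y=y'f$ be paths that end at the same vertex, with last edges $e$ and $f$ starting at $\alpha_1$ and $\alpha_2$, respectively, and put $\tilde\beta_i=\tilde\beta(\alpha_i)$. Then $\tilde\beta_1=\tilde\beta_2\mu$ or $\tilde\beta_2=\tilde\beta_1\mu$ for some word $\mu$. The pair $(x,y)$ is balanced if $L(x')=L(y')\mu$ in the former case and $L(x')\mu=L(y')$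 in the latter; its total label is then $L(x')$ in the former case and $L(y')$ in the latter. Let $\Omega_u$ be the set of all balanced pairs $(x,y)$ of paths that end at the same vertex, begin at distinct vertices and satisfy $\deg(x)=\deg(y)$. Assume that $\lambda_u(\mathcal D_n)=\mathcal D_n$. Then the following hold. (1) If $(x,y)\in\Omega_u$ has total label $\gamma$ and $x,y$ begin at $\alpha,\alpha'$, respectively, then $S_\alpha P_\gamma S_{\alpha'}^*\in\mathcal Z_u$. (2) Let $\alpha,\alpha'\in W_n^k$. If $\alpha\ne\alpha'$, then $S_\alpha S_{\alpha'}^*\in\langle\mathcal Z_u\rangle$ if and only if there is a finite collection $(x_1,y_1),\dots,(x_m,y_m)$ in $\Omega_u$, with total labels $\gamma_1,\dots,\gamma_m$, with all $x_j$ beginning at $\alpha$ and all $y_j$ beginning at $\alpha'$, such that $\sum_{j=1}^m P_{\gamma_j}=1$. If $\alpha=\alpha'$, the same equivalence holds with $\Omega_u$ replaced by the set of balanced pairs $(x,y)$ of paths that end at the same vertex and satisfy $\deg(x)=\deg(y)$ (the requirement of distinct first vertices being dropped). -/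

import Mathlib

open scoped ENNReal BoundedContinuousFunction

noncomputable section

/-! ### The Cuntz algebra -/

/-- Words (multi-indices) over the alphabet `{1, …, n}`: the set `Wₙ`. -/
abbrev CWord (n : ℕ) : Type := List (Fin n)

/-- Words of length `k`: the set `Wₙᵏ`. -/
abbrev CWordOfLength (n k : ℕ) : Type := List.Vector (Fin n) k

/-- The C*-algebra `B(ℓ²(ℕ))` of bounded operators on the separable infinite-dimensional
Hilbert space. -/
def BoundedOps : Type := lp (fun _ : ℕ => ℂ) 2 →L[ℂ] lp (fun _ : ℕ => ℂ) 2

instance : CStarAlgebra BoundedOps :=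
  inferInstanceAs (CStarAlgebra (lp (fun _ : ℕ => ℂ) 2 →L[ℂ] lp (fun _ : ℕ => ℂ) 2))

/-- An `n`-tuple of isometries of `ℓ²(ℕ)` whose range projections add up to the identity. -/
structure CuntzFamily (n : ℕ) : Type where
  op : Fin n → BoundedOps
  isometry : ∀ i, star (op i) * op i = 1
  sum_range : ∑ i, op i * star (op i) = 1

/-- The set of Cuntz families is used as an index set only. -/
instance (n : ℕ) : TopologicalSpace (CuntzFamily n) := ⊥

instance (n : ℕ) : DiscreteTopology (CuntzFamily n) := ⟨rfl⟩

/-- The C*-algebra of all bounded functions from the set of Cuntz families to `B(ℓ²(ℕ))`. -/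
abbrev CuntzAmbient (n : ℕ) : Type :=
  CuntzFamily n →ᵇ BoundedOps

theorem CuntzFamily.norm_le_one {n : ℕ} (T : CuntzFamily n) (i : Fin n) : ‖T.op i‖ ≤ 1 := by
  have h : ‖star (T.op i) * T.op i‖ = ‖T.op i‖ * ‖T.op i‖ := CStarRing.norm_star_mul_self
  have h1 : ‖(1 : BoundedOps)‖ ≤ 1 := by
    have h2 : ‖star (1 : BoundedOps) * 1‖ = ‖(1 : BoundedOps)‖ * ‖(1 : BoundedOps)‖ :=
      CStarRing.norm_star_mul_self
    rw [star_one, one_mul] at h2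
    nlinarith [norm_nonneg (1 : BoundedOps)]
  rw [T.isometry i] at h
  nlinarith [norm_nonneg (T.op i)]

/-- The `i`-th generator, the function `T ↦ Tᵢ`. -/
def cuntzAmbientGen (n : ℕ) (i : Fin n) : CuntzAmbient n :=
  BoundedContinuousFunction.ofNormedAddCommGroup (fun T => T.op i)
    continuous_of_discreteTopology 1 (fun T => T.norm_le_one i)

/-- The C*-subalgebra generated by the isometries `T ↦ Tᵢ`, `i = 1, …, n`. -/
def cuntzSubalgebra (n : ℕ) : StarSubalgebra ℂ (CuntzAmbient n) :=
  (StarAlgebra.adjoin ℂ (Set.range (cuntzAmbientGen n))).topologicalClosure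

theorem cuntzSubalgebra_isClosed (n : ℕ) : IsClosed (cuntzSubalgebra n : Set (CuntzAmbient n)) :=
  StarSubalgebra.isClosed_topologicalClosure _

theorem cuntzAmbientGen_mem (n : ℕ) (i : Fin n) : cuntzAmbientGen n i ∈ cuntzSubalgebra n :=
  StarSubalgebra.le_topologicalClosure _ (StarAlgebra.subset_adjoin ℂ _ ⟨i, rfl⟩)

/-- The Cuntz algebra `𝒪ₙ`: the C*-algebra generated by `n` isometries `S₁, …, Sₙ` with
`∑ Sᵢ Sᵢ* = 1`. It is realized by the direct sum of all representations of these relations on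
`ℓ²(ℕ)`. -/
def CuntzAlgebra (n : ℕ) : Type := cuntzSubalgebra n

instance (n : ℕ) : CStarAlgebra (CuntzAlgebra n) :=
  haveI := cuntzSubalgebra_isClosed n
  inferInstanceAs (CStarAlgebra (cuntzSubalgebra n))

namespace CuntzAlgebra

variable {n : ℕ}

/-- The inclusion of `𝒪ₙ` into the ambient C*-algebra. -/
def incl (n : ℕ) : CuntzAlgebra n →⋆ₐ[ℂ] CuntzAmbient n := (cuntzSubalgebra n).subtype

/-- The generating isometries `S₁, …, Sₙ`. -/
def S (i : Fin n) : CuntzAlgebra n := ⟨cuntzAmbientGen n i, cuntzAmbientGen_mem n i⟩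

theorem incl_injective : Function.Injective (incl n) := Subtype.val_injective

@[simp] theorem incl_S (i : Fin n) : incl n (S i) = cuntzAmbientGen n i := rfl

theorem star_S_mul_S (i : Fin n) : star (S i) * S i = 1 := by
  apply incl_injective
  rw [map_mul, map_star, map_one, incl_S]
  ext1 T
  exact T.isometry i

theorem sum_S_mul_star_S : ∑ i : Fin n, S i * star (S i) = 1 := by
  apply incl_injective
  rw [map_sum, map_one]
  ext1 T
  rw [BoundedContinuousFunction.sum_apply]
  exact T.sum_range

/-- A unitary `u` of `𝒪ₙ` turns each Cuntz family `T` into the Cuntz family `u(T) T₁, …, u(T) Tₙ`. -/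
def twist (u : unitary (CuntzAlgebra n)) (T : CuntzFamily n) : CuntzFamily n where
  op i := incl n u T * T.op i
  isometry i := by
    have h : star (incl n u T) * incl n u T = 1 := by
      have := congrArg (incl n) (Unitary.star_mul_self_of_mem u.2)
      rw [map_mul, map_star, map_one] at this
      exact congrArg (fun f : CuntzAmbient n => f T) this
    rw [star_mul, mul_assoc, ← mul_assoc (star (incl n u T)), h, one_mul, T.isometry i]
  sum_range := by
    have h : incl n u T * star (incl n u T) = 1 := by
      have := congrArg (incl n) (Unitary.mul_star_self_of_mem u.2)
      rw [map_mul, map_star, map_one] at this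
      exact congrArg (fun f : CuntzAmbient n => f T) this
    have h2 : ∀ i, incl n u T * T.op i * star (incl n u T * T.op i)
        = incl n u T * (T.op i * star (T.op i)) * star (incl n u T) := fun i => by
      simp only [star_mul, mul_assoc]
    simp only [h2]
    rw [← Finset.sum_mul, ← Finset.mul_sum, T.sum_range, mul_one, h]

/-- Substitution `f ↦ (T ↦ f (u(T) T₁, …, u(T) Tₙ))` on the ambient C*-algebra. -/
def twistHom (u : unitary (CuntzAlgebra n)) : CuntzAmbient n →⋆ₐ[ℂ] CuntzAmbient n where
  toFun f := f.compContinuous ⟨twist u, continuous_of_discreteTopology⟩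
  map_one' := rfl
  map_mul' _ _ := rfl
  map_zero' := rfl
  map_add' _ _ := rfl
  commutes' _ := rfl
  map_star' _ := rfl

theorem twistHom_gen (u : unitary (CuntzAlgebra n)) (i : Fin n) :
    twistHom u (cuntzAmbientGen n i) = incl n (u * S i) := rfl

theorem twistHom_mem (u : unitary (CuntzAlgebra n)) (x : CuntzAlgebra n) :
    twistHom u (incl n x) ∈ cuntzSubalgebra n := by
  have hc : Continuous (twistHom u) := BoundedContinuousFunction.continuous_compContinuous _
  have h : cuntzSubalgebra n ≤ (cuntzSubalgebra n).comap (twistHom u) := by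
    refine StarSubalgebra.topologicalClosure_minimal ?_
      ((cuntzSubalgebra_isClosed n).preimage hc)
    refine StarAlgebra.adjoin_le ?_
    rintro _ ⟨i, rfl⟩
    exact (u * S i : CuntzAlgebra n).2
  exact h x.2

/-- The endomorphism `λᵤ` of `𝒪ₙ` attached to a unitary `u`; it is determined by
`λᵤ(Sᵢ) = u Sᵢ`. -/
def lam (u : unitary (CuntzAlgebra n)) : CuntzAlgebra n →⋆ₐ[ℂ] CuntzAlgebra n :=
  ((twistHom u).comp (incl n)).codRestrict (cuntzSubalgebra n) (twistHom_mem u)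

theorem lam_S (u : unitary (CuntzAlgebra n)) (i : Fin n) : lam u (S i) = u * S i := rfl

/-- `S_μ = S_{μ₁} ⋯ S_{μ_k}`, with `S_∅ = 1`. -/
def Sw (μ : CWord n) : CuntzAlgebra n := (μ.map S).prod

/-- The standard projection `P_μ = S_μ S_μ*`. -/
def P (μ : CWord n) : CuntzAlgebra n := Sw μ * star (Sw μ)

/-- The diagonal `𝒟ₙ`: the C*-subalgebra of `𝒪ₙ` generated by all the projections `P_μ`. -/
def diagonal (n : ℕ) : StarSubalgebra ℂ (CuntzAlgebra n) :=
  (StarAlgebra.adjoin ℂ (Set.range (P (n := n)))).topologicalClosure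

/-! ### The graph `Δᵤ`

A unitary `u = ∑ S_α S_β*` in which all the words `α` have the same length `k` is presented by
`∑ S_α S_{β(α)}*`, where `α` runs over `Wₙᵏ`, for a function `β : Wₙᵏ → Wₙ`. -/

section Graph

variable {k : ℕ} (β : CWordOfLength n k → CWord n)

/-- The word `β̃`: the word `β` belonging to `α`, with its first letter removed. -/
def tld (α : CWordOfLength n k) : CWord n := (β α).tail

/-- `𝒵ᵤ`: all finite products of the elements `S_α S_β̃*` and their adjoints. -/
def Z : Set (CuntzAlgebra n) :=
  Subsemigroup.closure
    {z | ∃ α : CWordOfLength n k, z = Sw α.toList * star (Sw (tld β α)) ∨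
      z = star (Sw α.toList * star (Sw (tld β α)))}

/-- `⟨𝒵ᵤ⟩`: all finite sums of elements of `𝒵ᵤ`. -/
def sumsZ : Set (CuntzAlgebra n) := AddSubmonoid.closure (Z β)

/-- There is an edge of `Δᵤ` from `α₁` to `α₂` when `P_{α₂} ≤ P_{β̃₁}`, that is, when `β̃₁` is an
initial subword of `α₂`. -/
def Edge (α₁ α₂ : CWordOfLength n k) : Prop := tld β α₁ <+: α₂.toList

/-- The degree `|α| - |β̃|` of a vertex `α`, and of each edge emitted by `α`. (If
`|α| - |β| ∈ {0, 1, -1}` and `β` is not empty then it is `0`, `1` or `2`, so that the subtraction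
does not truncate.) -/
def vdeg (α : CWordOfLength n k) : ℕ := k - (tld β α).length

/-- Finite directed paths on `Δᵤ`, indexed by their first and last vertices. The path `snoc x e` is
the path `x` followed by the edge `e`. -/
inductive DPath : CWordOfLength n k → CWordOfLength n k → Type
  | nil (α : CWordOfLength n k) : DPath α α
  | snoc {α α₁ α₂ : CWordOfLength n k} (x : DPath α α₁) (e : Edge β α₁ α₂) : DPath α α₂

variable {β}

/-- The label `L(x)`: the concatenation of the labels of the edges, where the label of an edge of
degree `d` that ends at `α₂` is the terminal subword of length `d` of `α₂`. -/
def DPath.label {α ω : CWordOfLength n k} : DPath β α ω → CWord n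
  | .nil _ => []
  | .snoc (α₁ := α₁) (α₂ := α₂) x _ => x.label ++ α₂.toList.rtake (vdeg β α₁)

/-- The degree of a path: the sum of the degrees of its edges. -/
def DPath.deg {α ω : CWordOfLength n k} : DPath β α ω → ℕ
  | .nil _ => 0
  | .snoc (α₁ := α₁) x _ => x.deg + vdeg β α₁

/-- A pair of paths `x = x'e`, `y = y'f` with the same last vertex, where `e` starts at `α₁` and `f`
at `α₂`, is balanced if `β̃₁ = β̃₂μ` and `L(x') = L(y')μ`, or `β̃₂ = β̃₁μ` and `L(x')μ = L(y')`. -/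
def Balanced {α α' ω : CWordOfLength n k} : DPath β α ω → DPath β α' ω → Prop
  | .snoc (α₁ := α₁) x' _, .snoc (α₁ := α₂) y' _ =>
      ∃ μ : CWord n, (tld β α₁ = tld β α₂ ++ μ ∧ x'.label = y'.label ++ μ) ∨
        (tld β α₂ = tld β α₁ ++ μ ∧ x'.label ++ μ = y'.label)
  | _, _ => False

/-- The total label of a balanced pair `(x'e, y'f)`: it is `L(x')` if `β̃₁ = β̃₂μ`, and `L(y')` if
`β̃₂ = β̃₁μ`. (As `β̃₁` and `β̃₂` are initial subwords of the same word, the first case is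
`|β̃₂| ≤ |β̃₁|`.) -/
def totalLabel {α α' ω : CWordOfLength n k} : DPath β α ω → DPath β α' ω → CWord n
  | .snoc (α₁ := α₁) x' _, .snoc (α₁ := α₂) y' _ =>
      if (tld β α₂).length ≤ (tld β α₁).length then x'.label else y'.label
  | _, _ => []

/-- The set `Ωᵤ`: pairs of paths with the same last vertex (this is built into the types), distinct
first vertices and the same degree that are balanced. -/
def InOmega {α α' ω : CWordOfLength n k} (x : DPath β α ω) (y : DPath β α' ω) : Prop :=
  α ≠ α' ∧ x.deg = y.deg ∧ Balanced x y

end Graph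

end CuntzAlgebra

end

/-! Membership of `S_α P_γ S_α'*` in `𝒵ᵤ` is a telescoping computation: multiplying the generators
along a path `x` from `α` to `ω` gives `S_α S_{L(x)} S_{β̃(ω)}*`, and for a balanced pair the
product for `x'` times the adjoint of the product for `y'` is the required element (`DPath.mem_Z`,
`Balanced.mem_Z`). Summing over a family with `∑ P_γ = 1` gives one half of (2).

For the other half, represent `𝒪ₙ` on `ℓ²(ℕ)` by `Sᵢ e_m = e_{nm+i}` and let `f` be the map `α·m ↦
β̃(α)·m` of `ℕ`. An element of `⟨𝒵ᵤ⟩` has a nonzero matrix entry at `(p, q)` only if the `f`-orbits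
of `p` and `q` meet within `N` steps, with `N` independent of `p` and `q`. Hence, if `S_α S_α'*`
lies there, the orbits of `α·v` and `α'·v` meet for every `v`. Orbits trace paths in `Δᵤ` whose
labels are the digits of `v` used up on the way, so each meeting yields a balanced pair of equal
degrees (`exists_balanced_of_iterate_eq`). For `v = w·1` with `w` long, its total label is an
initial subword of `w`; finitely many such labels then partition the unit (`exists_sum_P_eq_one`).
-/

namespace CuntzAlgebra

variable {n k : ℕ}

/-! ### Words acting on `ℕ` through base `n` expansions -/

/-- The action of words on `ℕ` generated by `i · m = n m + i`. -/
def wordAct : CWord n → ℕ → ℕ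
  | [], m => m
  | i :: μ, m => n * wordAct μ m + i

@[simp] theorem wordAct_nil (m : ℕ) : wordAct ([] : CWord n) m = m := rfl

theorem wordAct_cons (i : Fin n) (μ : CWord n) (m : ℕ) :
    wordAct (i :: μ) m = n * wordAct μ m + i := rfl

theorem wordAct_append (μ ν : CWord n) (m : ℕ) :
    wordAct (μ ++ ν) m = wordAct μ (wordAct ν m) := by
  induction μ with
  | nil => rfl
  | cons i μ ih => rw [List.cons_append, wordAct_cons, wordAct_cons, ih]

theorem mul_add_fin_inj {i j : Fin n} {a b : ℕ} (h : n * a + i = n * b + j) : i = j ∧ a = b := by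
  have hn : 0 < n := i.pos
  have h1 : (i : ℕ) = j := by
    simpa [Nat.mul_add_mod, Nat.mod_eq_of_lt i.2, Nat.mod_eq_of_lt j.2] using congrArg (· % n) h
  refine ⟨Fin.ext h1, ?_⟩
  rw [h1] at h
  exact Nat.eq_of_mul_eq_mul_left hn (Nat.add_right_cancel h)

/-- Letters are base `n` digits, least significant first, so they can be compared and stripped one
at a time. -/
theorem exists_append_of_wordAct_eq {μ ν : CWord n} {a b : ℕ} (hl : μ.length ≤ ν.length)
    (h : wordAct μ a = wordAct ν b) : ∃ δ, ν = μ ++ δ ∧ a = wordAct δ b := by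
  induction μ generalizing ν with
  | nil => exact ⟨ν, rfl, h⟩
  | cons i μ ih =>
    cases ν with
    | nil => simp at hl
    | cons j ν =>
      obtain ⟨rfl, h'⟩ := mul_add_fin_inj h
      obtain ⟨δ, rfl, hδ⟩ := ih (by simpa using hl) h'
      exact ⟨δ, rfl, hδ⟩

theorem wordAct_injective (μ : CWord n) : Function.Injective (wordAct μ) := by
  intro a b h
  obtain ⟨δ, hδ, hab⟩ := exists_append_of_wordAct_eq le_rfl h
  rw [List.self_eq_append_right] at hδ
  simpa [hδ] using hab

/-- Each letter sends `m` to at least `2m`. The point `0` must be excluded: it is fixed by the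
letter `0`. -/
theorem lt_wordAct (hn : 2 ≤ n) {μ : CWord n} (hμ : μ ≠ []) {m : ℕ} (hm : m ≠ 0) :
    m < wordAct μ m := by
  induction μ with
  | nil => exact absurd rfl hμ
  | cons i μ ih =>
    have h : m ≤ wordAct μ m := by
      rcases eq_or_ne μ [] with rfl | h
      · exact le_rfl
      · exact (ih h).le
    rw [wordAct_cons]
    nlinarith [Nat.pos_of_ne_zero hm]

/-- Otherwise the longer word would extend the shorter one by a nonempty word fixing `m`. -/
theorem wordAct_left_cancel (hn : 2 ≤ n) {μ ν : CWord n} {m : ℕ} (hm : m ≠ 0)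
    (h : wordAct μ m = wordAct ν m) : μ = ν := by
  wlog hl : μ.length ≤ ν.length generalizing μ ν
  · exact (this h.symm (le_of_not_ge hl)).symm
  obtain ⟨δ, rfl, hδ⟩ := exists_append_of_wordAct_eq hl h
  rcases eq_or_ne δ [] with rfl | hδ'
  · simp
  · exact absurd hδ (lt_wordAct hn hδ' hm).ne

/-- The first `k` digits of `p`. -/
def digitsVec (n : ℕ) [NeZero n] : (k : ℕ) → ℕ → CWordOfLength n k
  | 0, _ => List.Vector.nil
  | k + 1, p => ⟨p % n, Nat.mod_lt _ (NeZero.pos n)⟩ ::ᵥ digitsVec n k (p / n)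

theorem wordAct_digitsVec [NeZero n] (k p : ℕ) :
    wordAct (digitsVec n k p).toList (p / n ^ k) = p := by
  induction k generalizing p with
  | zero => simp [digitsVec]
  | succ k ih =>
    rw [digitsVec, List.Vector.toList_cons, wordAct_cons, pow_succ', ← Nat.div_div_eq_div_mul, ih]
    exact Nat.div_add_mod p n

theorem digitsVec_wordAct [NeZero n] (α : CWordOfLength n k) (m : ℕ) :
    digitsVec n k (wordAct α.toList m) = α ∧ wordAct α.toList m / n ^ k = m := by
  obtain ⟨δ, h, h'⟩ := exists_append_of_wordAct_eq (by simp)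
    (wordAct_digitsVec (n := n) k (wordAct α.toList m))
  have hδ : δ = [] := by
    have := congrArg List.length h
    simpa using this
  subst hδ
  exact ⟨List.Vector.toList_injective (by simpa using h.symm), h'⟩

/-! ### The dynamics on `ℕ` defined by `β̃` -/

/-- Since `|β| ≤ k + 1`, removing a letter leaves at most `k`; an empty `β` causes no trouble, its
tail being empty. The degree hypothesis enters only in this form. -/
theorem length_tld_le {β : CWordOfLength n k → CWord n}
    (hβ : ∀ α, (k : ℤ) - ((β α).length : ℤ) ∈ ({0, 1, -1} : Set ℤ)) (α : CWordOfLength n k) :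
    (tld β α).length ≤ k := by
  have := hβ α
  simp only [Set.mem_insert_iff, Set.mem_singleton_iff] at this
  rw [tld, List.length_tail]
  omega

/-- An edge forces `|β̃| ≤ k`, so the subtraction in `vdeg` does not truncate and the label is
exactly what follows `β̃`. -/
theorem Edge.eq_append {β : CWordOfLength n k → CWord n} {α₁ α₂ : CWordOfLength n k} (e : Edge β α₁ α₂) :
    α₂.toList = tld β α₁ ++ α₂.toList.rtake (vdeg β α₁) := by
  obtain ⟨δ, h⟩ := e
  have h1 : α₂.toList.length - vdeg β α₁ = (tld β α₁).length := by
    have := congrArg List.length h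
    simp only [List.length_append, List.Vector.toList_length] at this
    rw [vdeg, List.Vector.toList_length]
    omega
  rw [List.rtake, h1, ← h]
  simp

theorem DPath.length_label {β : CWordOfLength n k → CWord n} {α ω : CWordOfLength n k}
    (x : DPath β α ω) : x.label.length = x.deg := by
  induction x with
  | nil => rfl
  | snoc x e ih =>
    rw [DPath.label, DPath.deg, List.length_append, ih, List.rtake, List.length_drop,
      List.Vector.toList_length]
    simp only [vdeg]
    omega

section Dynamics

variable (β : CWordOfLength n k → CWord n) [NeZero n]

/-- The map `α · m ↦ β̃(α) · m` on `ℕ`. -/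
def shiftMap (p : ℕ) : ℕ := wordAct (tld β (digitsVec n k p)) (p / n ^ k)

theorem shiftMap_wordAct (α : CWordOfLength n k) (m : ℕ) :
    shiftMap β (wordAct α.toList m) = wordAct (tld β α) m := by
  rw [shiftMap, (digitsVec_wordAct α m).1, (digitsVec_wordAct α m).2]

variable {β}

/-- One step of the dynamics follows one edge: after the first `k` digits are replaced by `β̃`, the
edge label is the block of digits that moves from the tail into the first `k` places. -/
theorem edge_shiftMap (hβ : ∀ α, (tld β α).length ≤ k) (p : ℕ) :
    Edge β (digitsVec n k p) (digitsVec n k (shiftMap β p)) ∧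
      p / n ^ k = wordAct ((digitsVec n k (shiftMap β p)).toList.rtake
        (vdeg β (digitsVec n k p))) (shiftMap β p / n ^ k) := by
  have h := wordAct_digitsVec (n := n) k (shiftMap β p)
  conv_rhs at h => rw [shiftMap]
  have e : Edge β (digitsVec n k p) (digitsVec n k (shiftMap β p)) := by
    obtain ⟨δ, hδ, -⟩ := exists_append_of_wordAct_eq (by simpa using hβ _) h.symm
    exact ⟨δ, hδ.symm⟩
  refine ⟨e, ?_⟩
  rw [e.eq_append, wordAct_append] at h
  exact (wordAct_injective _ h).symm

theorem exists_path_iterate (hβ : ∀ α, (tld β α).length ≤ k) (p s : ℕ) :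
    ∃ x : DPath β (digitsVec n k p) (digitsVec n k ((shiftMap β)^[s] p)),
      p / n ^ k = wordAct x.label ((shiftMap β)^[s] p / n ^ k) ∧ x.label.length ≤ k * s := by
  induction s with
  | zero => exact ⟨.nil _, rfl, by simp [DPath.label]⟩
  | succ s ih =>
    obtain ⟨x, hx, hl⟩ := ih
    rw [Function.iterate_succ_apply']
    obtain ⟨e, he⟩ := edge_shiftMap hβ ((shiftMap β)^[s] p)
    refine ⟨.snoc x e, ?_, ?_⟩
    · rw [DPath.label, wordAct_append, ← he, hx]
    · have : (List.rtake (digitsVec n k (shiftMap β ((shiftMap β)^[s] p))).toList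
          (vdeg β (digitsVec n k ((shiftMap β)^[s] p)))).length ≤ k := by
        simp only [List.rtake, List.length_drop, List.Vector.toList_length, vdeg]
        omega
      rw [DPath.label, List.length_append, mul_add, mul_one]
      exact Nat.add_le_add hl this

theorem exists_path_iterate_wordAct (hβ : ∀ α, (tld β α).length ≤ k) (α : CWordOfLength n k)
    (v s : ℕ) :
    ∃ x : DPath β α (digitsVec n k ((shiftMap β)^[s] (wordAct α.toList v))),
      v = wordAct x.label ((shiftMap β)^[s] (wordAct α.toList v) / n ^ k) ∧
        x.label.length ≤ k * s := by
  have h := exists_path_iterate hβ (wordAct α.toList v) s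
  generalize (shiftMap β)^[s] (wordAct α.toList v) = p at *
  rwa [(digitsVec_wordAct α v).1, (digitsVec_wordAct α v).2] at h

/-- Points `α · v` and `α' · v` whose orbits meet yield a balanced pair, provided that `v` is large
enough to prevent periodicity. -/
theorem exists_balanced_of_iterate_eq (hn : 2 ≤ n) (hβ : ∀ α, (tld β α).length ≤ k)
    {α α' : CWordOfLength n k} {v s t M : ℕ} (hs : s < M) (ht : t < M)
    {w : CWord n} (hw : w.length = k * M) (hv : v = wordAct w 1)
    (h : (shiftMap β)^[s + 1] (wordAct α.toList v) = (shiftMap β)^[t + 1] (wordAct α'.toList v)) :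
    ∃ (ω : CWordOfLength n k) (x : DPath β α ω) (y : DPath β α' ω),
      (x.deg = y.deg ∧ Balanced x y) ∧ totalLabel x y <+: w := by
  -- A label reached within `M` steps has length at most `kM = |w|`, so it is an initial subword of
  -- `w`; the remaining tail is a word applied to `1`, hence nonzero, as cancellation requires.
  have key : ∀ {L : CWord n} {m : ℕ}, L.length ≤ k * M → v = wordAct L m → m ≠ 0 ∧ L <+: w := by
    intro L m hL hm
    obtain ⟨δ, hδ, rfl⟩ := exists_append_of_wordAct_eq (hL.trans hw.ge) (hm.symm.trans hv)
    refine ⟨?_, δ, hδ.symm⟩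
    rcases eq_or_ne δ [] with rfl | hδ'
    · simp
    · exact (lt_trans Nat.one_pos (lt_wordAct hn hδ' one_ne_zero)).ne'
  obtain ⟨x, hx, hxl⟩ := exists_path_iterate_wordAct hβ α v s
  obtain ⟨y, hy, hyl⟩ := exists_path_iterate_wordAct hβ α' v t
  rw [Function.iterate_succ_apply', Function.iterate_succ_apply'] at h
  generalize (shiftMap β)^[s] (wordAct α.toList v) = p at *
  generalize (shiftMap β)^[t] (wordAct α'.toList v) = q at *
  have e := (edge_shiftMap hβ p).1
  have f := (edge_shiftMap hβ q).1
  rw [← h] at f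
  generalize digitsVec n k (shiftMap β p) = ω at e f
  rw [shiftMap, shiftMap] at h
  generalize digitsVec n k p = a at *
  generalize digitsVec n k q = b at *
  generalize p / n ^ k = v₁ at *
  generalize q / n ^ k = v₂ at *
  obtain ⟨hv₁, hxw⟩ := key (hxl.trans (Nat.mul_le_mul_left k hs.le)) hx
  obtain ⟨hv₂, hyw⟩ := key (hyl.trans (Nat.mul_le_mul_left k ht.le)) hy
  have hd : ∀ c, vdeg β c + (tld β c).length = k := fun c => Nat.sub_add_cancel (hβ c)
  have hda := hd a
  have hdb := hd b
  refine ⟨ω, .snoc x e, .snoc y f, ?_⟩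
  rw [DPath.deg, DPath.deg, ← x.length_label, ← y.length_label, totalLabel]
  by_cases hl : (tld β b).length ≤ (tld β a).length
  · obtain ⟨μ, hμ, rfl⟩ := exists_append_of_wordAct_eq hl h.symm
    rw [← wordAct_append] at hy
    -- Here `v = L(x')·v₁ = L(y')μ·v₁`, so the balance condition is freeness of the action at `v₁`.
    have hL := wordAct_left_cancel hn hv₁ (hx.symm.trans hy)
    rw [if_pos hl]
    refine ⟨⟨?_, μ, .inl ⟨hμ, hL⟩⟩, hxw⟩
    -- Equality of degrees follows from balance: `μ` lengthens `L(x')` and shortens the degree of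
    -- the last edge by the same amount.
    rw [hμ, List.length_append] at hda
    rw [hL, List.length_append]
    omega
  · obtain ⟨μ, hμ, rfl⟩ := exists_append_of_wordAct_eq (le_of_not_ge hl) h
    rw [← wordAct_append] at hx
    have hL := wordAct_left_cancel hn hv₂ (hx.symm.trans hy)
    rw [if_neg hl]
    refine ⟨⟨?_, μ, .inr ⟨hμ, hL⟩⟩, hyw⟩
    rw [hμ, List.length_append] at hdb
    rw [← hL, List.length_append]
    omega

end Dynamics

/-! ### Words in the generators -/

@[simp] theorem Sw_nil : Sw ([] : CWord n) = 1 := rfl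

theorem Sw_cons (i : Fin n) (μ : CWord n) : Sw (i :: μ) = S i * Sw μ := by
  simp [Sw]

theorem Sw_append (μ ν : CWord n) : Sw (μ ++ ν) = Sw μ * Sw ν := by
  simp [Sw]

@[simp] theorem star_Sw_mul_Sw (μ : CWord n) : star (Sw μ) * Sw μ = 1 := by
  induction μ with
  | nil => simp
  | cons i μ ih =>
    rw [Sw_cons, star_mul, mul_assoc, ← mul_assoc (star (S i)), star_S_mul_S, one_mul, ih]

theorem star_Sw_mul_Sw_append (μ ν : CWord n) : star (Sw μ) * Sw (μ ++ ν) = Sw ν := by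
  rw [Sw_append, ← mul_assoc, star_Sw_mul_Sw, one_mul]

theorem star_Sw_append_mul_Sw (μ ν : CWord n) : star (Sw (μ ++ ν)) * Sw μ = star (Sw ν) := by
  rw [Sw_append, star_mul, mul_assoc, star_Sw_mul_Sw, mul_one]

theorem P_cons (i : Fin n) (μ : CWord n) : P (i :: μ) = S i * P μ * star (S i) := by
  simp only [P, Sw_cons, star_mul, mul_assoc]

/-- If every word of length `M` has an initial subword in `G`, then finitely many words in `G` have
projections adding up to `1`. -/
theorem exists_sum_P_eq_one (M : ℕ) (G : CWord n → Prop)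
    (hG : ∀ w : CWord n, w.length = M → ∃ γ, G γ ∧ γ <+: w) :
    ∃ l : List (CWord n), (∀ γ ∈ l, G γ) ∧ (l.map P).sum = 1 := by
  induction M generalizing G with
  | zero =>
    obtain ⟨γ, hγ, h⟩ := hG [] rfl
    rw [List.prefix_nil] at h
    subst h
    exact ⟨[[]], by simpa using hγ, by simp [P]⟩
  | succ M ih =>
    -- If the empty word is not in `G`, all prefixes found are nonempty, so the problem splits over
    -- the first letter and `∑ Sᵢ 1 Sᵢ* = 1` reassembles it.
    by_cases h0 : G []
    · exact ⟨[[]], by simpa using h0, by simp [P]⟩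
    have h : ∀ i : Fin n, ∃ l : List (CWord n), (∀ γ ∈ l, G (i :: γ)) ∧ (l.map P).sum = 1 := by
      intro i
      refine ih (fun γ => G (i :: γ)) fun w hw => ?_
      obtain ⟨γ, hγ, hp⟩ := hG (i :: w) (by simp [hw])
      cases γ with
      | nil => exact absurd hγ h0
      | cons j γ =>
        rw [List.cons_prefix_cons] at hp
        obtain ⟨rfl, hp⟩ := hp
        exact ⟨γ, hγ, hp⟩
    choose l hl hs using h
    refine ⟨(List.finRange n).flatMap fun i => (l i).map (i :: ·), ?_, ?_⟩
    · intro γ hγ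
      simp only [List.mem_flatMap, List.mem_map] at hγ
      obtain ⟨i, -, δ, hδ, rfl⟩ := hγ
      exact hl i δ hδ
    · have hi : ∀ i : Fin n, (((l i).map (i :: ·)).map P).sum = S i * star (S i) := by
        intro i
        have : P ∘ (fun γ : CWord n => i :: γ) = fun γ => S i * P γ * star (S i) :=
          funext fun γ => P_cons i γ
        rw [List.map_map, this, List.sum_map_mul_right, List.sum_map_mul_left, hs, mul_one]
      rw [List.map_flatMap, List.flatMap, List.sum_flatten, List.map_map]
      have : (List.sum ∘ fun i => ((l i).map (i :: ·)).map P) =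
          fun i : Fin n => S i * star (S i) := funext hi
      rw [this, ← sum_S_mul_star_S, ← List.ofFn_eq_map, List.sum_ofFn]

/-! ### Balanced pairs give elements of `𝒵ᵤ` -/

section Graph

variable {β : CWordOfLength n k → CWord n}

theorem mul_mem_Z {a b : CuntzAlgebra n} (ha : a ∈ Z β) (hb : b ∈ Z β) : a * b ∈ Z β :=
  Subsemigroup.mul_mem _ ha hb

theorem gen_mem_Z (α : CWordOfLength n k) : Sw α.toList * star (Sw (tld β α)) ∈ Z β :=
  Subsemigroup.subset_closure ⟨α, .inl rfl⟩

theorem star_mem_Z {a : CuntzAlgebra n} (ha : a ∈ Z β) : star a ∈ Z β := by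
  induction ha using Subsemigroup.closure_induction with
  | mem a ha =>
    obtain ⟨α, rfl | rfl⟩ := ha
    · exact Subsemigroup.subset_closure ⟨α, .inr rfl⟩
    · rw [star_star]
      exact gen_mem_Z α
  | mul a b _ _ iha ihb =>
    rw [star_mul]
    exact mul_mem_Z ihb iha

/-- Consecutive generators telescope, because `S_{β̃(α₁)}* S_{α₂}` is `S` of the edge label. The
last vertex contributes its own generator, hence the factor `S_{β̃(ω)}*`. -/
theorem DPath.mem_Z {α ω : CWordOfLength n k} (x : DPath β α ω) :
    Sw α.toList * Sw x.label * star (Sw (tld β ω)) ∈ Z β := by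
  induction x with
  | nil =>
    rw [DPath.label, Sw_nil, mul_one]
    exact gen_mem_Z _
  | @snoc _ a x e ih =>
    have h := mul_mem_Z ih (gen_mem_Z a)
    rw [mul_assoc, ← mul_assoc (star _), e.eq_append, star_Sw_mul_Sw_append] at h
    rw [DPath.label, Sw_append]
    simpa only [mul_assoc] using h

theorem Balanced.mem_Z {α α' ω : CWordOfLength n k} {x : DPath β α ω} {y : DPath β α' ω}
    (h : Balanced x y) :
    Sw α.toList * P (totalLabel x y) * star (Sw α'.toList) ∈ Z β := by
  cases x with
  | nil => exact h.elim
  | @snoc a _ x e =>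
  cases y with
  | nil => exact h.elim
  | @snoc b _ y f =>
  have hz := mul_mem_Z x.mem_Z (star_mem_Z y.mem_Z)
  obtain ⟨μ, ⟨hμ, hL⟩ | ⟨hμ, hL⟩⟩ := h
  · have ht : totalLabel (x.snoc e) (y.snoc f) = x.label := by
      rw [totalLabel, if_pos (by simp [hμ])]
    rw [ht]
    convert hz using 1
    simp only [star_mul, star_star, mul_assoc, P]
    rw [← mul_assoc (star (Sw (tld β a))), hμ, star_Sw_append_mul_Sw]
    conv_lhs => rw [hL]
    simp only [Sw_append, star_mul, mul_assoc]
    rw [hL, Sw_append]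
    simp only [mul_assoc]
  · have ht : totalLabel (x.snoc e) (y.snoc f) = y.label := by
      rw [totalLabel]
      split_ifs with hl
      -- In the overlap of the two cases `|β̃₁| = |β̃₂|`, and both choices of total label agree.
      · have : μ = [] := by
          rw [hμ, List.length_append] at hl
          exact List.length_eq_zero_iff.1 (by omega)
        rw [← hL, this, List.append_nil]
      · rfl
    rw [ht]
    convert hz using 1
    simp only [star_mul, star_star, mul_assoc, P]
    rw [← mul_assoc (star (Sw (tld β a))), hμ, star_Sw_mul_Sw_append, ← hL]
    simp only [Sw_append, mul_assoc]

end Graph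

/-! ### A representation of `𝒪ₙ` on `ℓ²(ℕ)` by partial injections of `ℕ` -/

/-- The Hilbert space `ℓ²(ℕ)`. -/
abbrev SeqSpace : Type := lp (fun _ : ℕ => ℂ) 2

/-- The standard basis vectors of `ℓ²(ℕ)`. -/
noncomputable def basisVec (m : ℕ) : SeqSpace := lp.single 2 m (1 : ℂ)

theorem basisVec_apply (m p : ℕ) : basisVec m p = if p = m then 1 else 0 := by
  rw [basisVec, lp.single_apply, Pi.single_apply]

theorem inner_basisVec (m : ℕ) (f : SeqSpace) : inner ℂ (basisVec m) f = f m := by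
  rw [basisVec, lp.inner_single_left]
  simp

theorem orthonormal_basisVec : Orthonormal ℂ basisVec := by
  rw [orthonormal_iff_ite]
  intro i j
  rw [inner_basisVec, basisVec_apply]

theorem basisVec_ext {A B : SeqSpace →L[ℂ] SeqSpace} (h : ∀ m, A (basisVec m) = B (basisVec m)) :
    A = B := by
  refine lp.ext_continuousLinearMap (by simp) fun m => ?_
  refine ContinuousLinearMap.ext_ring ?_
  exact h m

/-- The isometry `e_m ↦ e_{f m}`. -/
noncomputable def basisIsometry {f : ℕ → ℕ} (hf : Function.Injective f) :
    SeqSpace →ₗᵢ[ℂ] SeqSpace :=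
  (orthonormal_basisVec.comp f hf).orthogonalFamily.linearIsometry

theorem basisIsometry_basisVec {f : ℕ → ℕ} (hf : Function.Injective f) (m : ℕ) :
    basisIsometry hf (basisVec m) = basisVec (f m) := by
  rw [basisIsometry]
  conv_lhs => rw [basisVec]
  rw [OrthogonalFamily.linearIsometry_apply_single]
  simp

theorem mul_add_fin_injective (i : Fin n) : Function.Injective fun m : ℕ => n * m + i :=
  fun _ _ h => (mul_add_fin_inj h).2

/-- The isometry `e_m ↦ e_{nm+i}`. -/
noncomputable def digitOp (i : Fin n) : SeqSpace →L[ℂ] SeqSpace :=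
  (basisIsometry (mul_add_fin_injective i)).toContinuousLinearMap

theorem digitOp_basisVec (i : Fin n) (m : ℕ) : digitOp i (basisVec m) = basisVec (n * m + i) :=
  basisIsometry_basisVec (mul_add_fin_injective i) m

theorem star_digitOp_basisVec (i j : Fin n) (m : ℕ) :
    star (digitOp i) (basisVec (n * m + j)) = if i = j then basisVec m else 0 := by
  ext p
  rw [← inner_basisVec, ContinuousLinearMap.star_eq_adjoint,
    ContinuousLinearMap.adjoint_inner_right, digitOp_basisVec, inner_basisVec, basisVec_apply]
  by_cases hij : i = j
  · subst hij
    simp [basisVec_apply, i.pos.ne']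
  · rw [if_neg hij, if_neg fun h => hij (mul_add_fin_inj h).1]
    rfl

theorem exists_eq_mul_add_fin [NeZero n] (q : ℕ) : ∃ (j : Fin n) (m : ℕ), q = n * m + j :=
  ⟨⟨q % n, Nat.mod_lt _ (NeZero.pos n)⟩, q / n, (Nat.div_add_mod q n).symm⟩

/-- The Cuntz family `e_m ↦ e_{nm+i}` on `ℓ²(ℕ)`. -/
noncomputable def digitFamily (n : ℕ) [NeZero n] : CuntzFamily n where
  op i := digitOp i
  isometry i := LinearIsometry.adjoint_comp_self (basisIsometry (mul_add_fin_injective i))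
  sum_range := by
    change (∑ i : Fin n, digitOp i * star (digitOp i)) = (1 : SeqSpace →L[ℂ] SeqSpace)
    refine basisVec_ext fun q => ?_
    obtain ⟨j, m, rfl⟩ := exists_eq_mul_add_fin (n := n) q
    rw [sum_apply, Finset.sum_eq_single j]
    · rw [mul_apply_eq_comp, star_digitOp_basisVec, if_pos rfl, digitOp_basisVec]
      rfl
    · intro i _ hij
      rw [mul_apply_eq_comp, star_digitOp_basisVec, if_neg hij, map_zero]
    · simp

/-- The representation of `𝒪ₙ` on `ℓ²(ℕ)` with `Sᵢ e_m = e_{nm+i}`. -/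
noncomputable def digitRep [NeZero n] (a : CuntzAlgebra n) : SeqSpace →L[ℂ] SeqSpace :=
  incl n a (digitFamily n)

section Rep

variable [NeZero n]

theorem digitRep_zero : digitRep (0 : CuntzAlgebra n) = 0 := by
  rw [digitRep, map_zero]; rfl

theorem digitRep_one : digitRep (1 : CuntzAlgebra n) = 1 := by
  rw [digitRep, map_one]; rfl

theorem digitRep_add (a b : CuntzAlgebra n) : digitRep (a + b) = digitRep a + digitRep b := by
  rw [digitRep, map_add]; rfl

theorem digitRep_mul (a b : CuntzAlgebra n) : digitRep (a * b) = digitRep a * digitRep b := by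
  rw [digitRep, map_mul]; rfl

theorem digitRep_star (a : CuntzAlgebra n) : digitRep (star a) = star (digitRep a) := by
  rw [digitRep, map_star]; rfl

theorem digitRep_S (i : Fin n) : digitRep (S i) = digitOp i := rfl

theorem digitRep_Sw_basisVec (μ : CWord n) (m : ℕ) :
    digitRep (Sw μ) (basisVec m) = basisVec (wordAct μ m) := by
  induction μ with
  | nil => rw [Sw_nil, digitRep_one]; rfl
  | cons i μ ih =>
    rw [Sw_cons, digitRep_mul, mul_apply_eq_comp, ih, digitRep_S, digitOp_basisVec,
      wordAct_cons]

theorem digitRep_star_Sw_basisVec (μ : CWord n) (q : ℕ) :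
    digitRep (star (Sw μ)) (basisVec q) = 0 ∨
      ∃ m, q = wordAct μ m ∧ digitRep (star (Sw μ)) (basisVec q) = basisVec m := by
  induction μ generalizing q with
  | nil => exact .inr ⟨q, rfl, by rw [Sw_nil, star_one, digitRep_one]; rfl⟩
  | cons i μ ih =>
    obtain ⟨j, m, rfl⟩ := exists_eq_mul_add_fin (n := n) q
    rw [Sw_cons, star_mul, digitRep_mul, mul_apply_eq_comp, digitRep_star (S i),
      digitRep_S, star_digitOp_basisVec]
    by_cases hij : i = j
    · subst hij
      rw [if_pos rfl]
      obtain h | ⟨p, rfl, h⟩ := ih m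
      · exact .inl h
      · exact .inr ⟨p, rfl, h⟩
    · rw [if_neg hij, map_zero]
      exact .inl rfl

variable {β : CWordOfLength n k → CWord n}

/-- Elements of `𝒵ᵤ` move basis vectors along orbits of the map `α · m ↦ β̃(α) · m`. -/
theorem exists_iterate_bound_of_mem_Z {z : CuntzAlgebra n} (hz : z ∈ Z β) :
    ∃ N, ∀ q, digitRep z (basisVec q) = 0 ∨ ∃ p, digitRep z (basisVec q) = basisVec p ∧
      ∃ s t, s ≤ N ∧ t ≤ N ∧ (shiftMap β)^[s] p = (shiftMap β)^[t] q := by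
  induction hz using Subsemigroup.closure_induction with
  | mem z hz =>
    refine ⟨1, fun q => ?_⟩
    obtain ⟨α, rfl | rfl⟩ := hz
    · rw [digitRep_mul, mul_apply_eq_comp]
      obtain h | ⟨m, rfl, h⟩ := digitRep_star_Sw_basisVec (tld β α) q
      · rw [h, map_zero]
        exact .inl rfl
      · rw [h, digitRep_Sw_basisVec]
        exact .inr ⟨_, rfl, 1, 0, le_rfl, zero_le_one, shiftMap_wordAct β α m⟩
    · rw [star_mul, star_star, digitRep_mul, mul_apply_eq_comp]
      obtain h | ⟨m, rfl, h⟩ := digitRep_star_Sw_basisVec α.toList q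
      · rw [h, map_zero]
        exact .inl rfl
      · rw [h, digitRep_Sw_basisVec]
        exact .inr ⟨_, rfl, 0, 1, zero_le_one, le_rfl, (shiftMap_wordAct β α m).symm⟩
  | mul a b _ _ iha ihb =>
    obtain ⟨N, hN⟩ := iha
    obtain ⟨N', hN'⟩ := ihb
    refine ⟨N + N', fun q => ?_⟩
    rw [digitRep_mul, mul_apply_eq_comp]
    obtain h | ⟨r, h, s', t', hs', ht', hr⟩ := hN' q
    · rw [h, map_zero]
      exact .inl rfl
    rw [h]
    obtain h | ⟨p, h, s, t, hs, ht, hp⟩ := hN r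
    · exact .inl h
    -- Iterates of one map commute, so meeting times add along `p`, `r`, `q`.
    refine .inr ⟨p, h, s' + s, t + t', by omega, by omega, ?_⟩
    rw [Function.iterate_add_apply, hp, ← Function.iterate_add_apply, add_comm s',
      Function.iterate_add_apply, hr, ← Function.iterate_add_apply]

/-- A nonzero entry of a sum is nonzero in some summand, so possible cancellation is harmless and
the larger bound serves. -/
theorem exists_iterate_bound_of_mem_sumsZ {z : CuntzAlgebra n} (hz : z ∈ sumsZ β) :
    ∃ N, ∀ p q, digitRep z (basisVec q) p ≠ 0 →
      ∃ s t, s ≤ N ∧ t ≤ N ∧ (shiftMap β)^[s] p = (shiftMap β)^[t] q := by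
  induction hz using AddSubmonoid.closure_induction with
  | mem z hz =>
    obtain ⟨N, hN⟩ := exists_iterate_bound_of_mem_Z hz
    refine ⟨N, fun p q h => ?_⟩
    obtain h0 | ⟨p', h', hp'⟩ := hN q
    · rw [h0] at h
      exact absurd rfl h
    · rw [h', basisVec_apply] at h
      obtain rfl : p = p' := by simpa using h
      exact hp'
  | zero => exact ⟨0, fun p q h => absurd (by rw [digitRep_zero]; rfl) h⟩
  | add a b _ _ iha ihb =>
    obtain ⟨N, hN⟩ := iha
    obtain ⟨N', hN'⟩ := ihb
    refine ⟨max N N', fun p q h => ?_⟩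
    rw [digitRep_add, add_apply, lp.coeFn_add, Pi.add_apply] at h
    by_cases ha : digitRep a (basisVec q) p = 0
    · rw [ha, zero_add] at h
      obtain ⟨s, t, hs, ht, hst⟩ := hN' p q h
      exact ⟨s, t, le_max_of_le_right hs, le_max_of_le_right ht, hst⟩
    · obtain ⟨s, t, hs, ht, hst⟩ := hN p q ha
      exact ⟨s, t, le_max_of_le_left hs, le_max_of_le_left ht, hst⟩

/-! ### The two implications of part (2) -/

theorem exists_sum_P_totalLabel_eq_one (hn : 2 ≤ n) (hβ : ∀ α, (tld β α).length ≤ k)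
    {α α' : CWordOfLength n k} (hz : Sw α.toList * star (Sw α'.toList) ∈ sumsZ β) :
    ∃ (m : ℕ) (ω : Fin m → CWordOfLength n k)
      (x : ∀ j, DPath β α (ω j)) (y : ∀ j, DPath β α' (ω j)),
      (∀ j, (x j).deg = (y j).deg ∧ Balanced (x j) (y j)) ∧
        1 = ∑ j, P (totalLabel (x j) (y j)) := by
  obtain ⟨N, hN⟩ := exists_iterate_bound_of_mem_sumsZ hz
  obtain ⟨l, hl, hsum⟩ := exists_sum_P_eq_one (k * (N + 1))
    (fun γ => ∃ (ω : CWordOfLength n k) (x : DPath β α ω) (y : DPath β α' ω),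
      (x.deg = y.deg ∧ Balanced x y) ∧ totalLabel x y = γ) fun w hw => by
    -- `S_α S_α'*` sends the basis vector at `α'·v` to the one at `α·v`, where `v = w·1`.
    obtain ⟨s, t, hs, ht, hst⟩ := hN (wordAct α.toList (wordAct w 1))
      (wordAct α'.toList (wordAct w 1)) (by
        rw [← digitRep_Sw_basisVec, ← mul_apply_eq_comp, ← digitRep_mul, mul_assoc,
          star_Sw_mul_Sw, mul_one, digitRep_Sw_basisVec, basisVec_apply, if_pos rfl]
        exact one_ne_zero)
    obtain ⟨ω, x, y, h, hp⟩ := exists_balanced_of_iterate_eq hn hβ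
      (Nat.lt_succ_of_le hs) (Nat.lt_succ_of_le ht) hw rfl
      -- One more step after the meeting supplies the last edges `e` and `f`, which exist even when
      -- `s` or `t` is zero.
      (by rw [Function.iterate_succ_apply', hst, ← Function.iterate_succ_apply' (shiftMap β)])
    exact ⟨_, ⟨ω, x, y, h, rfl⟩, hp⟩
  choose ω x y h hL using fun j : Fin l.length => hl (l.get j) (l.get_mem j)
  refine ⟨l.length, ω, x, y, h, ?_⟩
  simp only [hL]
  rw [← hsum, ← List.sum_ofFn]
  congr 1
  exact (List.ofFn_comp' l.get P).symm ▸ by rw [List.ofFn_get]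

end Rep

theorem mem_sumsZ_of_sum_P_eq_one {β : CWordOfLength n k → CWord n} {α α' : CWordOfLength n k}
    {m : ℕ} {ω : Fin m → CWordOfLength n k} {x : ∀ j, DPath β α (ω j)}
    {y : ∀ j, DPath β α' (ω j)} (h : ∀ j, Balanced (x j) (y j))
    (hsum : 1 = ∑ j, P (totalLabel (x j) (y j))) :
    Sw α.toList * star (Sw α'.toList) ∈ sumsZ β := by
  have : Sw α.toList * star (Sw α'.toList) =
      ∑ j, Sw α.toList * P (totalLabel (x j) (y j)) * star (Sw α'.toList) := by
    rw [← Finset.sum_mul, ← Finset.mul_sum, ← hsum, mul_one]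
  rw [this]
  exact AddSubmonoid.sum_mem _ fun j _ => AddSubmonoid.subset_closure (h j).mem_Z

end CuntzAlgebra

theorem proposition4p3 (n : ℕ) (hn : 2 ≤ n) (k : ℕ) (hk : 1 ≤ k)
    (β : CWordOfLength n k → CWord n)
    (hβ : ∀ α, (k : ℤ) - ((β α).length : ℤ) ∈ ({0, 1, -1} : Set ℤ))
    (u : unitary (CuntzAlgebra n))
    (hu : (u : CuntzAlgebra n) = ∑ α : CWordOfLength n k,
      CuntzAlgebra.Sw α.toList * star (CuntzAlgebra.Sw (β α)))
    (hD : (CuntzAlgebra.diagonal n).map (CuntzAlgebra.lam u) = CuntzAlgebra.diagonal n) :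
    -- part (1)
    (∀ (α α' ω : CWordOfLength n k) (x : CuntzAlgebra.DPath β α ω) (y : CuntzAlgebra.DPath β α' ω),
      CuntzAlgebra.InOmega x y →
        CuntzAlgebra.Sw α.toList * CuntzAlgebra.P (CuntzAlgebra.totalLabel x y) *
          star (CuntzAlgebra.Sw α'.toList) ∈ CuntzAlgebra.Z β) ∧
    -- part (2) for distinct `α` and `α'`
    (∀ α α' : CWordOfLength n k, α ≠ α' →
      (CuntzAlgebra.Sw α.toList * star (CuntzAlgebra.Sw α'.toList) ∈ CuntzAlgebra.sumsZ β ↔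
        ∃ (m : ℕ) (ω : Fin m → CWordOfLength n k)
          (x : ∀ j, CuntzAlgebra.DPath β α (ω j)) (y : ∀ j, CuntzAlgebra.DPath β α' (ω j)),
          (∀ j, CuntzAlgebra.InOmega (x j) (y j)) ∧
          1 = ∑ j, CuntzAlgebra.P (CuntzAlgebra.totalLabel (x j) (y j)))) ∧
    -- part (2) for `α = α'`, where the requirement of distinct first vertices is dropped
    (∀ α : CWordOfLength n k,
      (CuntzAlgebra.Sw α.toList * star (CuntzAlgebra.Sw α.toList) ∈ CuntzAlgebra.sumsZ β ↔
        ∃ (m : ℕ) (ω : Fin m → CWordOfLength n k)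
          (x : ∀ j, CuntzAlgebra.DPath β α (ω j)) (y : ∀ j, CuntzAlgebra.DPath β α (ω j)),
          (∀ j, (x j).deg = (y j).deg ∧ CuntzAlgebra.Balanced (x j) (y j)) ∧
          1 = ∑ j, CuntzAlgebra.P (CuntzAlgebra.totalLabel (x j) (y j)))) := by
  have : NeZero n := ⟨by omega⟩
  have hβ' := CuntzAlgebra.length_tld_le hβ
  refine ⟨fun α α' ω x y h => h.2.2.mem_Z, fun α α' hne => ⟨fun hz => ?_, ?_⟩,
    fun α => ⟨CuntzAlgebra.exists_sum_P_totalLabel_eq_one hn hβ', ?_⟩⟩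
  · obtain ⟨m, ω, x, y, h, hsum⟩ := CuntzAlgebra.exists_sum_P_totalLabel_eq_one hn hβ' hz
    exact ⟨m, ω, x, y, fun j => ⟨hne, h j⟩, hsum⟩
  · rintro ⟨m, ω, x, y, h, hsum⟩
    exact CuntzAlgebra.mem_sumsZ_of_sum_P_eq_one (fun j => (h j).2.2) hsum
  · rintro ⟨m, ω, x, y, h, hsum⟩
    exact CuntzAlgebra.mem_sumsZ_of_sum_P_eq_one (fun j => (h j).2) hsum
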